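/- Let $n\ge 3$ and $[n]=\{1,2,\dots,n\}$. A universal cycle for the $2$-permutations of $[n]$ is a cyclic arrangement $(x_1,x_2,\dots,x_{n(n-1)})$ of elements of $[n]$ (sequences that differ by a rotation are identified) in which each ordered pair $(a,b)$ of distinct elements of $[n]$ appears exactly once as two consecutive entries, that is, $(a,b)=(x_i,x_{i+1})$ for exactly one index $i\in\{1,\dots,n(n-1)\}$, where $x_{n(n-1)+1}=x_1$. The number of universal cycles for the $2$-permutations of $[n]$ is $$n^{n-2}\,[(n-2)!]^{n}.$$ -/

import Mathlib

open scoped Nat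

/-- A `k`-permutation of an `n`-set, here `Fin n`: an ordered arrangement of `k` distinct
elements, the `j`-th of which is `p j`. -/
abbrev KPermutation (n k : ℕ) : Type := Fin k ↪ Fin n

/-- The blocks of `k` consecutive elements of a cyclic arrangement `c`, counted with multiplicity:
one for each position of `c`, namely the first `k` entries of `c` read cyclically from there. -/
def cyclicBlocks {α : Type*} (k : ℕ) (c : Cycle α) : Multiset (List α) :=
  c.lists.map (List.take k)

/-- A universal cycle for the `k`-permutations of `Fin n`: a cyclic arrangement of elements of
`Fin n` whose length is the number of `k`-permutations, and in which each `k`-permutation appears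
exactly once as `k` consecutive elements. Two sequences that are rotations of each other are the
same `Cycle`. -/
def IsUniversalCycle (n k : ℕ) (c : Cycle (Fin n)) : Prop :=
  c.length = Fintype.card (KPermutation n k) ∧
    ∀ p : KPermutation n k, (cyclicBlocks k c).count (List.ofFn p) = 1

/-! Reading off the sources of consecutive edges turns Eulerian circuits of the complete digraph on
`Fin n` into universal cycles, bijectively (`ncard_isUniversalCycle_two`). Circuits of a balanced
digraph are counted by a form of the BEST theorem, `eulerCount_eq_prod_mul_det`: the product of the
(indegree - 1)! times the determinant of the Laplacian with 1 added at a root r. For the complete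
digraph all indegrees are n - 1 and the matrix is nI - J + E_rr, of determinant n^(n-2).

The BEST formula is proved by induction on the number of edges, without counting trees. Take an edge
u → v with v ≠ r. A circuit follows it by some edge v → w, and fusing the two into u → w leaves a
circuit with one edge fewer (`eulerCount_option`). If other edges enter v, fusion is a rank one
perturbation of the Laplacian, and summing over the choices of v → w multiplies the determinant by
indegree(v) - 1 (`sum_det_sub_vecMulVec`), which is exactly the factor lost by the factorials. If u
→ v is the only edge into v, fusion isolates v; the 1 then placed on the diagonal preserves the
determinant (`det_sub_vecMulVec_add_of_row_col`), so the vertex set never has to change. In the base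
case all m edges are loops at r, with (m - 1)! circuits. -/

/-! ### Determinant identities -/

open Matrix in
/-- Summing the determinants of rank one perturbations of `M` along a fixed column vector `a`,
when the row vectors add up to a row of `M`. -/
theorem sum_det_sub_vecMulVec {V ι R : Type*} [Fintype V] [DecidableEq V] [CommRing R]
    (M : Matrix V V R) (a : V → R) (S : Finset ι) (δ : ι → V → R) (v : V)
    (hδ : ∑ i ∈ S, δ i = M v) :
    ∑ i ∈ S, (M - vecMulVec a (δ i)).det = (S.card - a v) * M.det := by
  -- By the Schur complement, each perturbed determinant is that of `M` bordered by the column `a`,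
  -- the row `δ i` and the corner 1, hence linear in the last row.
  set B : Matrix (V ⊕ Unit) (V ⊕ Unit) R := fromBlocks M (replicateCol Unit a) 0 1 with hB
  have hupd : ∀ (x : V → R) (c : R), B.updateRow (Sum.inr ()) (Sum.elim x fun _ => c) =
      fromBlocks M (replicateCol Unit a) (replicateRow Unit x) (of fun _ _ => c) := by
    intro x c
    ext (i | i) (j | j) <;> simp [hB, updateRow_apply]
  set D : (V ⊕ Unit → R) →ₗ[R] R :=
    (detRowAlternating (R := R) (n := V ⊕ Unit)).toMultilinearMap.toLinearMap B (Sum.inr ())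
  have hD : ∀ x, D x = (B.updateRow (Sum.inr ()) x).det := fun _ => rfl
  have h1 : ∀ i, (M - vecMulVec a (δ i)).det = D (Sum.elim (δ i) fun _ => 1) := by
    intro i
    have := hupd (δ i) 1
    have h2 : (of fun _ _ => 1 : Matrix Unit Unit R) = 1 := by ext; simp
    rw [h2] at this
    rw [hD, this, det_fromBlocks_one₂₂]
    congr 2
    ext x y
    simp [vecMulVec_apply, mul_apply]
  simp_rw [h1]
  rw [← map_sum]
  -- The summed last row is (`M v`, |S|). Subtracting row `v` of `B`, which is (`M v`, `a v`),
  -- leaves only the corner entry.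
  have h3 : (∑ i ∈ S, Sum.elim (δ i) fun _ => (1 : R) : V ⊕ Unit → R) =
      Sum.elim (0 : V → R) (fun _ => S.card - a v) + B (Sum.inl v) := by
    ext (x | x)
    · simp [Finset.sum_apply, hB, ← hδ]
    · simp [Finset.sum_apply, hB]
  rw [h3, hD]
  have h4 : B (Sum.inl v) = (B.updateRow (Sum.inr ())
      (Sum.elim (0 : V → R) (fun _ => S.card - a v))) (Sum.inl v) := by
    simp [updateRow_ne]
  have h5 := det_updateRow_add_self (B.updateRow (Sum.inr ())
      (Sum.elim (0 : V → R) (fun _ => S.card - a v)))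
      (i := Sum.inr ()) (j := Sum.inl v) (by simp)
  rw [← h4, updateRow_self, updateRow_idem] at h5
  rw [h5, hupd]
  have : replicateRow Unit (0 : V → R) = 0 := by ext; simp
  rw [this, det_fromBlocks_zero₂₁]
  simp [mul_comm]

-- Adding row `v` to row `u` and column `v` to column `w` clears row and column `v` off the
-- diagonal; these transvections have determinant 1.
open Matrix in
theorem det_sub_vecMulVec_add_of_row_col {V R : Type*} [Fintype V] [DecidableEq V] [CommRing R]
    (M : Matrix V V R) {u v w : V} (hu : u ≠ v) (hw : w ≠ v)
    (hrow : M v = Pi.single v 1 - Pi.single w 1)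
    (hcol : M.col v = Pi.single v 1 - Pi.single u 1) :
    (M - vecMulVec (Pi.single v 1 - Pi.single u 1) (Pi.single v 1 - Pi.single w 1) +
      Matrix.single v v 1).det = M.det := by
  have h : M - vecMulVec (Pi.single v 1 - Pi.single u 1) (Pi.single v 1 - Pi.single w 1) +
      Matrix.single v v 1 = transvection u v 1 * M * transvection v w 1 := by
    have e1 : Matrix.single u v (1 : R) * M = vecMulVec (Pi.single u 1) (M v) := by
      ext i j
      by_cases hi : i = u
      · subst hi; simp [vecMulVec_apply]
      · simp [hi, vecMulVec_apply]
    have e2 : M * Matrix.single v w (1 : R) = vecMulVec (M.col v) (Pi.single w 1) := by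
      ext i j
      by_cases hi : j = w
      · subst hi; simp [vecMulVec_apply]
      · simp [hi, vecMulVec_apply]
    have e3 : Matrix.single u v (1 : R) * M * Matrix.single v w 1 = Matrix.single u w 1 := by
      have : M v v = 1 := by simp [hrow, hw.symm]
      rw [Matrix.single_mul_mul_single, this]; simp
    have e4 : ∀ i j : V, Matrix.single i j (1 : R) = vecMulVec (Pi.single i 1) (Pi.single j 1) := by
      intro i j
      ext x y
      simp [vecMulVec_apply, Matrix.single_apply, Pi.single_apply, ← ite_and, eq_comm, and_comm]
    rw [transvection, transvection, add_mul, mul_add, mul_one, one_mul, add_mul, e3, e1,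
      e2, hrow, hcol, e4, e4]
    simp only [sub_vecMulVec, vecMulVec_sub]
    abel
  rw [h, det_mul, det_mul, det_transvection_of_ne _ _ hu, det_transvection_of_ne _ _ hw.symm]
  simp

open Matrix in
theorem det_smul_one_sub_ones_add_single {n : ℕ} (hn : 2 ≤ n) (r : Fin n) :
    ((n : ℚ) • (1 : Matrix (Fin n) (Fin n) ℚ) - vecMulVec 1 1 + Matrix.single r r 1).det =
      (n : ℚ) ^ (n - 2) := by
  have hn0 : (n : ℚ) ≠ 0 := by positivity
  set b : Fin n → ℚ := fun i => if i = r then n + 1 else n with hb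
  have hb0 : ∀ i, b i ≠ 0 := by intro i; simp only [hb]; split_ifs <;> positivity
  -- Factoring out the diagonal leaves a rank one perturbation of the identity, to which the matrix
  -- determinant lemma applies.
  have h : (n : ℚ) • (1 : Matrix (Fin n) (Fin n) ℚ) - vecMulVec 1 1 + Matrix.single r r 1 =
      diagonal b * (1 + vecMulVec (-b⁻¹) 1) := by
    ext i j
    rw [diagonal_mul]
    have := hb0 i
    by_cases hij : i = j
    · subst hij
      by_cases hr : r = i
      · subst hr
        simp [mul_add, this]
        simp [hb]
      · simp [mul_add, this, hr]
        simp [hb, Ne.symm hr]; ring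
    · have : ¬ (r = i ∧ r = j) := fun h => hij (h.1 ▸ h.2)
      simp [hb0 i, hij, this]
  rw [h, det_mul, vecMulVec_eq Unit, det_one_add_replicateCol_mul_replicateRow, det_diagonal]
  have h1 : ∏ i, b i = (n + 1) * (n : ℚ) ^ (n - 1) := by
    rw [← Finset.mul_prod_erase _ _ (Finset.mem_univ r),
      Finset.prod_congr rfl (g := fun _ => (n : ℚ))]
    · simp [hb]
    · intro i hi
      simp [hb, Finset.ne_of_mem_erase hi]
  have h2 : ∑ i, (b i)⁻¹ = (n + 1 : ℚ)⁻¹ + (n - 1) * (n : ℚ)⁻¹ := by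
    rw [← Finset.add_sum_erase _ _ (Finset.mem_univ r),
      Finset.sum_congr rfl (g := fun _ => (n : ℚ)⁻¹)]
    · simp [hb, Nat.cast_sub (show 1 ≤ n by omega)]
    · intro i hi
      simp [hb, Finset.ne_of_mem_erase hi]
  have h3 : (1 : Fin n → ℚ) ⬝ᵥ (-b⁻¹) = -((n + 1 : ℚ)⁻¹ + (n - 1) * (n : ℚ)⁻¹) := by
    rw [← h2]; simp [dotProduct]
  rw [h1, h3]
  obtain ⟨k, rfl⟩ := Nat.exists_eq_add_of_le' hn
  have : ((k + 2 : ℕ) : ℚ) + 1 ≠ 0 := by positivity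
  simp only [show k + 2 - 1 = k + 1 by omega, show k + 2 - 2 = k by omega]
  rw [pow_succ]
  field_simp
  ring

/-! ### Single-orbit permutations and Eulerian circuits -/

/-- `σ` has a single orbit. -/
def IsFullCycle {E : Type*} (σ : Equiv.Perm E) : Prop := ∀ x y, σ.SameCycle x y

theorem Equiv.Perm.SameCycle.of_forall_rel {E : Type*} {σ : Equiv.Perm E} {R : E → E → Prop}
    (hR : Equivalence R) (h : ∀ x, R x (σ x)) {x y : E} (hxy : σ.SameCycle x y) : R x y := by
  obtain ⟨i, rfl⟩ := hxy
  induction i with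
  | zero => exact hR.refl _
  | succ i ih =>
    rw [add_comm, zpow_add, Equiv.Perm.mul_apply, zpow_one]
    exact hR.trans ih (h _)
  | pred i ih =>
    refine hR.trans ih (hR.symm ?_)
    have := h ((σ ^ (-(i : ℤ) - 1)) x)
    rwa [← Equiv.Perm.mul_apply, ← zpow_one_add, add_sub_cancel] at this

/-- `τ` is the permutation induced on `α` when the point `none`, which precedes `some i`, is
skipped. -/
theorem isFullCycle_decomposeOption_symm {α : Type*} [DecidableEq α] (i : α) (τ : Equiv.Perm α) :
    IsFullCycle (Equiv.Perm.decomposeOption.symm (some i, τ)) ↔ IsFullCycle τ := by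
  set σ := Equiv.Perm.decomposeOption.symm (some i, τ) with hσ
  have hnone : σ none = some i := by simp [hσ]
  have hsome : ∀ x, σ (some x) = if τ x = i then none else some (τ x) := by
    intro x
    simp only [hσ, Equiv.Perm.decomposeOption_symm_apply, Equiv.Perm.mul_apply,
      Equiv.optionCongr_apply, Option.map_some]
    split_ifs with h
    · simp [h]
    · rw [Equiv.swap_apply_of_ne_of_ne] <;> simp [h]
  constructor
  · intro h x y
    -- Collapsing `none` onto `i` sends each step of `σ` to a step of `τ` or to no step.
    have key := (h (some x) (some y)).of_forall_rel
      (R := fun a b => τ.SameCycle (a.getD i) (b.getD i))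
      ((Equiv.Perm.SameCycle.equivalence τ).comap fun a : Option α => a.getD i) (fun a => by
        cases a with
        | none => simp [hnone, Equiv.Perm.SameCycle.refl]
        | some x =>
          rw [hsome]
          split_ifs with hx
          · simpa [← hx] using Equiv.Perm.SameCycle.refl τ x
          · simpa using Equiv.Perm.SameCycle.refl τ x)
    simpa using key
  · intro h
    have hs : ∀ x y : α, σ.SameCycle (some x) (some y) := fun x y =>
      (h x y).of_forall_rel (R := fun a b => σ.SameCycle (some a) (some b))
        ((Equiv.Perm.SameCycle.equivalence σ).comap some) (fun a => by
          by_cases ha : τ a = i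
          · have h2 : σ (σ (some a)) = some (τ a) := by rw [hsome, if_pos ha, hnone, ha]
            rw [← h2]; simp [Equiv.Perm.SameCycle.refl]
          · have h2 : σ (some a) = some (τ a) := by rw [hsome, if_neg ha]
            rw [← h2]; simp [Equiv.Perm.SameCycle.refl])
    have hn : σ.SameCycle none (some i) := by
      rw [← hnone]; simp [Equiv.Perm.SameCycle.refl]
    rintro (_ | x) (_ | y)
    · exact .refl _ _
    · exact hn.trans (hs _ _)
    · exact ((hs _ _).trans hn.symm)
    · exact hs _ _

theorem not_isFullCycle_decomposeOption_symm_none {α : Type*} [DecidableEq α] [Nonempty α]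
    (τ : Equiv.Perm α) : ¬ IsFullCycle (Equiv.Perm.decomposeOption.symm (none, τ)) := by
  intro h
  obtain ⟨x⟩ := ‹Nonempty α›
  have := (h none (some x)).eq_of_left (by simp [Function.IsFixedPt])
  simp at this

/-- The number of Eulerian circuits of the digraph with edges `E`, sources `s` and targets `t`,
each circuit being given by its successor map on edges. -/
noncomputable def eulerCount {E V : Type*} (s t : E → V) : ℕ :=
  Nat.card {σ : Equiv.Perm E // IsFullCycle σ ∧ ∀ e, s (σ e) = t e}

theorem eulerCount_comp_equiv {E E' V : Type*} (f : E' ≃ E)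
    (s t : E → V) : eulerCount (s ∘ f) (t ∘ f) = eulerCount s t := by
  refine Nat.card_congr (Equiv.subtypeEquiv f.permCongr fun σ => ?_)
  have hsame : ∀ x y, (f.permCongr σ).SameCycle (f x) (f y) ↔ σ.SameCycle x y := by
    intro x y
    have hp : ∀ i : ℤ, (f.permCongr σ) ^ i = f.permCongr (σ ^ i) := fun i =>
      (map_zpow f.permCongrHom σ i).symm
    simp [Equiv.Perm.SameCycle, hp]
  constructor
  · rintro ⟨h1, h2⟩
    refine ⟨fun x y => ?_, fun e => ?_⟩
    · simpa using (hsame (f.symm x) (f.symm y)).2 (h1 _ _)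
    · simpa using h2 (f.symm e)
  · rintro ⟨h1, h2⟩
    refine ⟨fun x y => (hsame x y).1 (h1 _ _), fun e => ?_⟩
    simpa using h2 (f e)

/-- Circuits are sorted by the edge `i` that follows `none`. The two edges are fused: `i` keeps its
target and takes the source of `none`. -/
theorem eulerCount_option {α V : Type*} [Fintype α] [DecidableEq α] [DecidableEq V] [Nonempty α]
    (s t : Option α → V) :
    eulerCount s t = ∑ i : α with s (some i) = t none,
      eulerCount (Function.update (s ∘ some) i (s none)) (t ∘ some) := by
  classical
  have hsome : ∀ (i : α) (τ : Equiv.Perm α) x, Equiv.Perm.decomposeOption.symm (some i, τ) (some x)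
      = if τ x = i then none else some (τ x) := by
    intro i τ x
    simp only [Equiv.Perm.decomposeOption_symm_apply, Equiv.Perm.mul_apply,
      Equiv.optionCongr_apply, Option.map_some]
    split_ifs with h
    · simp [h]
    · rw [Equiv.swap_apply_of_ne_of_ne] <;> simp [h]
  have hcond : ∀ (i : α) (τ : Equiv.Perm α),
      (∀ e, s (Equiv.Perm.decomposeOption.symm (some i, τ) e) = t e) ↔
      s (some i) = t none ∧
        ∀ e, Function.update (s ∘ some) i (s none) (τ e) = (t ∘ some) e := by
    intro i τ
    rw [Option.forall]
    refine and_congr (by simp) (forall_congr' fun x => ?_)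
    rw [hsome]
    by_cases h : τ x = i
    · simp [h]
    · simp [h]
  have hcard : eulerCount s t = ∑ i : Option α, ∑ τ : Equiv.Perm α,
      if (IsFullCycle (Equiv.Perm.decomposeOption.symm (i, τ)) ∧
        ∀ e, s (Equiv.Perm.decomposeOption.symm (i, τ) e) = t e) then 1 else 0 := by
    rw [← Fintype.sum_prod_type', eulerCount, Nat.card_eq_fintype_card, Fintype.card_subtype, Finset.card_filter]
    exact (Equiv.sum_comp Equiv.Perm.decomposeOption.symm (fun σ : Equiv.Perm (Option α) =>
      if (IsFullCycle σ ∧ ∀ e, s (σ e) = t e) then 1 else 0)).symm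
  rw [hcard, Fintype.sum_option]
  simp only [not_isFullCycle_decomposeOption_symm_none, false_and, if_false, Finset.sum_const_zero,
    zero_add, isFullCycle_decomposeOption_symm, hcond]
  rw [Finset.sum_filter]
  refine Finset.sum_congr rfl fun i _ => ?_
  split_ifs with h
  · rw [eulerCount, Nat.card_eq_fintype_card, Fintype.card_subtype, Finset.card_filter]
    simp [h]
  · simp [h]

theorem eulerCount_of_unique {E V : Type*} [Fintype E] (h1 : Fintype.card E = 1) (s t : E → V)
    (h : ∀ e, s e = t e) : eulerCount s t = 1 := by
  obtain ⟨x, hx⟩ := Fintype.card_eq_one_iff.1 h1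
  classical
  have : Unique E := ⟨⟨x⟩, hx⟩
  rw [eulerCount, Nat.card_eq_fintype_card, Fintype.card_eq_one_iff]
  exact ⟨⟨1, fun x y => by rw [Subsingleton.elim x y], h⟩, fun y => Subsingleton.elim _ _⟩

theorem eulerCount_of_const {E V : Type*} [Fintype E] [Nonempty E] (s t : E → V)
    (r : V) (hs : ∀ e, s e = r) (ht : ∀ e, t e = r) :
    eulerCount s t = (Fintype.card E - 1)! := by
  classical
  induction hE : Fintype.card E generalizing E with
  | zero => simp at hE
  | succ n ih =>
    obtain rfl | hn := Nat.eq_zero_or_pos n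
    · rw [eulerCount_of_unique (by simpa using hE)]
      · rfl
      · simp [hs, ht]
    · obtain ⟨e⟩ := ‹Nonempty E›
      have hc : Fintype.card {b // b ≠ e} = n := by
        rw [Fintype.card_subtype_compl, hE]; simp
      have : Nonempty {b // b ≠ e} := Fintype.card_pos_iff.1 (by omega)
      -- The removed loop can be fused with any of the `n` others, each time leaving `n` loops.
      rw [← eulerCount_comp_equiv (Equiv.optionSubtypeNe e), eulerCount_option,
        Finset.sum_congr rfl (g := fun _ => (n - 1)!)]
      · simp only [Finset.sum_const, Function.comp, hs, ht, Finset.filter_true, Finset.card_univ,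
          hc, smul_eq_mul, Nat.add_sub_cancel]
        exact Nat.mul_factorial_pred hn.ne'
      · intro i _
        exact ih _ _ (fun x => by simp [Function.update_apply, hs]) (by simp [ht]) hc

/-! ### The Laplacian under fusion of edges, and the BEST formula -/

open Matrix in
/-- The Laplacian of the digraph with edges `E`, sources `s` and targets `t`, with `1` added to the
diagonal entries of the root `r` and of the vertices that are not a target. -/
def rootedLaplacian {E V : Type*} [Fintype E] [Fintype V] [DecidableEq V] (r : V) (s t : E → V) :
    Matrix V V ℚ :=
  ∑ e, vecMulVec (Pi.single (s e) 1) (Pi.single (s e) 1 - Pi.single (t e) 1) +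
    diagonal fun w => if w = r ∨ ∀ e, t e ≠ w then 1 else 0

theorem rootedLaplacian_comp_equiv {E E' V : Type*} [Fintype E] [Fintype E'] [Fintype V]
    [DecidableEq V] (f : E' ≃ E) (r : V) (s t : E → V) :
    rootedLaplacian r (s ∘ f) (t ∘ f) = rootedLaplacian r s t := by
  simp only [rootedLaplacian, Function.comp_apply]
  congr 1
  · exact Equiv.sum_comp f fun e =>
      Matrix.vecMulVec (Pi.single (s e) (1 : ℚ)) (Pi.single (s e) 1 - Pi.single (t e) 1)
  · simp only [f.forall_congr_left, Equiv.apply_symm_apply]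

theorem sum_update_comp_some {α V A : Type*} [Fintype α] [DecidableEq α] [AddCommGroup A]
    (F : V → V → A) (s t : Option α → V) (i : α) :
    ∑ x, F (Function.update (s ∘ some) i (s none) x) (t (some x)) =
      ∑ e, F (s e) (t e) - F (s none) (t none) - F (s (some i)) (t (some i)) +
        F (s none) (t (some i)) := by
  rw [Fintype.sum_option, ← Finset.add_sum_erase _ _ (Finset.mem_univ i),
    ← Finset.add_sum_erase _ (fun x => F (s (some x)) (t (some x))) (Finset.mem_univ i),
    Finset.sum_congr rfl (g := fun x => F (s (some x)) (t (some x)))]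
  · simp only [Function.update_self]
    abel
  · intro x hx
    simp [Finset.ne_of_mem_erase hx]

theorem card_source_eq_card_target {E V : Type*} [Fintype E] [DecidableEq V] {s t : E → V}
    (hbal : ∀ g : V → ℚ, ∑ e, g (s e) = ∑ e, g (t e)) (v : V) :
    Finset.card {e | s e = v} = Finset.card {e | t e = v} := by
  have := hbal fun w => if w = v then 1 else 0
  simpa using this

/-- Only the indegree of `t none` drops. If it drops to 0, the truncated subtraction makes both
factors 0! = 1. -/
theorem prod_factorial_card_option {α V : Type*} [Fintype α] [Fintype V]
    [DecidableEq V] (t : Option α → V) :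
    ∏ w, (Finset.card {e | t e = w} - 1)! =
      (if ∃ x, t (some x) = t none then Finset.card {e | t e = t none} - 1 else 1) *
        ∏ w, (Finset.card {x | t (some x) = w} - 1)! := by
  have hcard : ∀ w, Finset.card {e | t e = w} =
      (if t none = w then 1 else 0) + Finset.card {x | t (some x) = w} := by
    intro w
    simp only [Finset.card_filter, Fintype.sum_option]
  rw [← Finset.mul_prod_erase _ _ (Finset.mem_univ (t none)),
    ← Finset.mul_prod_erase Finset.univ (fun w => (Finset.card {x | t (some x) = w} - 1)!)
      (Finset.mem_univ (t none)),
    Finset.prod_congr rfl (s₁ := Finset.univ.erase (t none))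
      (g := fun w => (Finset.card {x | t (some x) = w} - 1)!), ← mul_assoc]
  · congr 1
    rw [hcard, if_pos rfl, Nat.add_sub_cancel_left]
    split_ifs with h
    · refine (Nat.mul_factorial_pred ?_).symm
      obtain ⟨x, hx⟩ := h
      exact Finset.card_ne_zero_of_mem (a := x) (by simpa using hx)
    · have : Finset.card {x | t (some x) = t none} = 0 := by
        rw [Finset.card_eq_zero, Finset.filter_eq_empty_iff]
        exact fun x _ hx => h ⟨x, hx⟩
      simp [this]
  · intro w hw
    rw [hcard, if_neg (Finset.ne_of_mem_erase hw).symm, zero_add]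

section

variable {α V : Type*} [Fintype α] [DecidableEq α] [Fintype V] [DecidableEq V]

-- With u → v the edge `none` and v → w the edge `i`, the Laplacian loses (e_v - e_u)(e_v - e_w)ᵀ.
-- The last term appears when v ceases to be a target.
open Matrix in
theorem rootedLaplacian_update (r : V) (s t : Option α → V) (i : α)
    (hr : t none ≠ r) (hi : s (some i) = t none) :
    rootedLaplacian r (Function.update (s ∘ some) i (s none)) (t ∘ some) =
      rootedLaplacian r s t -
        vecMulVec (Pi.single (t none) 1 - Pi.single (s none) 1)
          (Pi.single (t none) 1 - Pi.single (t (some i)) 1) +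
        if ∀ x, t (some x) ≠ t none then Matrix.single (t none) (t none) 1 else 0 := by
  have hd : (diagonal fun w => if w = r ∨ ∀ e, (t ∘ some) e ≠ w then (1 : ℚ) else 0) =
      (diagonal fun w => if w = r ∨ ∀ e, t e ≠ w then (1 : ℚ) else 0) +
        if ∀ x, t (some x) ≠ t none then Matrix.single (t none) (t none) 1 else 0 := by
    split_ifs with h
    · rw [← diagonal_single, diagonal_add]
      congr 1
      ext w
      by_cases hw : w = t none
      · subst hw
        simp [hr, h, Option.forall]
      · simp [hw, Option.forall, Ne.symm hw]
    · rw [add_zero]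
      congr 1
      ext w
      by_cases hw : w = t none
      · subst hw
        simpa [hr, Option.forall] using h
      · simp [Option.forall, Ne.symm hw]
  rw [rootedLaplacian, rootedLaplacian, hd]
  have := sum_update_comp_some (fun a b : V =>
    vecMulVec (Pi.single a (1 : ℚ)) (Pi.single a 1 - Pi.single b 1)) s t i
  simp only [Function.comp_apply]
  rw [this, hi]
  simp only [sub_vecMulVec, vecMulVec_sub]
  abel

open Matrix in
theorem rootedLaplacian_apply_row {E : Type*} [Fintype E] (r : V) (s t : E → V) {v : V}
    (hv : v ≠ r) (h : ∃ e, t e = v) :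
    rootedLaplacian r s t v =
      ∑ e with s e = v, ((Pi.single v 1 : V → ℚ) - Pi.single (t e) 1) := by
  rw [Finset.sum_filter]
  ext w
  have : (diagonal fun w => if w = r ∨ ∀ e, t e ≠ w then (1 : ℚ) else 0) v w = 0 := by
    by_cases hw : v = w
    · subst hw; simpa [hv] using h
    · simp [hw]
  rw [rootedLaplacian, Matrix.add_apply, this, add_zero, Matrix.sum_apply, Finset.sum_apply]
  refine Finset.sum_congr rfl fun e _ => ?_
  rw [vecMulVec_apply]
  by_cases he : s e = v
  · simp [he]
  · simp [he, Ne.symm he]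

open Matrix in
theorem rootedLaplacian_col {E : Type*} [Fintype E] (r : V) (s t : E → V) {v : V}
    (hv : v ≠ r) (h : ∃ e, t e = v) :
    (rootedLaplacian r s t).col v =
      ∑ e with s e = v, (Pi.single v 1 : V → ℚ) - ∑ e with t e = v, Pi.single (s e) 1 := by
  rw [Finset.sum_filter, Finset.sum_filter, ← Finset.sum_sub_distrib]
  ext w
  have : (diagonal fun w => if w = r ∨ ∀ e, t e ≠ w then (1 : ℚ) else 0) w v = 0 := by
    by_cases hw : v = w
    · subst hw; simpa [hv] using h
    · simp [Ne.symm hw]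
  rw [col_apply, rootedLaplacian, Matrix.add_apply, this, add_zero, Matrix.sum_apply,
    Finset.sum_apply]
  refine Finset.sum_congr rfl fun e _ => ?_
  rw [vecMulVec_apply]
  by_cases he : s e = v <;> by_cases he' : t e = v <;>
    simp [he, he', Pi.single_apply, eq_comm]

open Matrix in
/-- The determinants of the Laplacians obtained by splitting off the edge `none` from its target,
in all possible ways. -/
theorem sum_det_rootedLaplacian_update (r : V) (s t : Option α → V)
    (hbal : ∀ g : V → ℚ, ∑ e, g (s e) = ∑ e, g (t e)) (hr : t none ≠ r)
    (hsome : ∃ x, t (some x) = t none) :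
    ∑ i : α with s (some i) = t none,
      (rootedLaplacian r (Function.update (s ∘ some) i (s none)) (t ∘ some)).det =
      (Finset.card {e | t e = t none} - 1) * (rootedLaplacian r s t).det := by
  set M := rootedLaplacian r s t with hM
  set a : V → ℚ := Pi.single (t none) 1 - Pi.single (s none) 1 with ha
  have h1 := sum_det_sub_vecMulVec M a {e | s e = t none}
    (fun e => Pi.single (t none) 1 - Pi.single (t e) 1) (t none)
    (rootedLaplacian_apply_row r s t hr ⟨none, rfl⟩).symm
  rw [card_source_eq_card_target hbal, Finset.sum_filter, Fintype.sum_option] at h1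
  rw [Finset.sum_filter]
  have h2 : ∀ i : α, (if s (some i) = t none then
      (rootedLaplacian r (Function.update (s ∘ some) i (s none)) (t ∘ some)).det else 0) =
      if s (some i) = t none then
        (M - vecMulVec a (Pi.single (t none) 1 - Pi.single (t (some i)) 1)).det else 0 := by
    intro i
    split_ifs with hi
    · rw [rootedLaplacian_update r s t i hr hi, if_neg (by simpa using hsome), add_zero]
    · rfl
  simp_rw [h2]
  -- If `none` is a loop, the sum in `h1` has an extra term det `M`, while `a` = 0; otherwise there
  -- is no extra term and `a (t none)` = 1. Both give indegree - 1.
  by_cases hl : s none = t none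
  · have ha0 : a = 0 := by simp [ha, hl]
    rw [if_pos hl] at h1
    simp only [sub_self, vecMulVec_zero, sub_zero, ha0, Pi.zero_apply] at h1 ⊢
    linear_combination h1
  · have ha1 : a (t none) = 1 := by simp [ha, Ne.symm hl]
    rw [if_neg hl, ha1] at h1
    linear_combination h1

open Matrix in
theorem sum_det_rootedLaplacian_update_of_forall_ne (r : V) (s t : Option α → V)
    (hbal : ∀ g : V → ℚ, ∑ e, g (s e) = ∑ e, g (t e)) (hr : t none ≠ r)
    (hsome : ∀ x, t (some x) ≠ t none) :
    ∑ i : α with s (some i) = t none,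
      (rootedLaplacian r (Function.update (s ∘ some) i (s none)) (t ∘ some)).det =
      (rootedLaplacian r s t).det := by
  have ht1 : ({e | t e = t none} : Finset (Option α)) = {none} := by
    ext e; cases e <;> simp [hsome]
  have hs1 := card_source_eq_card_target hbal (t none)
  rw [ht1, Finset.card_singleton, Finset.card_eq_one] at hs1
  obtain ⟨e, he⟩ := hs1
  have hmem : ∀ x, s x = t none ↔ x = e := fun x => by simpa using Finset.ext_iff.1 he x
  have hrow := rootedLaplacian_apply_row r s t hr ⟨none, rfl⟩
  rw [he, Finset.sum_singleton] at hrow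
  cases e with
  | none =>
    -- Here `none` is a loop and the only edge at its vertex: the sum is empty and the Laplacian has
    -- a zero row.
    rw [sub_self] at hrow
    rw [det_eq_zero_of_row_eq_zero (t none) (fun j => congrFun hrow j)]
    simp [hmem]
  | some i =>
    have hcol := rootedLaplacian_col r s t hr ⟨none, rfl⟩
    rw [he, ht1, Finset.sum_singleton, Finset.sum_singleton] at hcol
    have hfil : ({x | s (some x) = t none} : Finset α) = {i} := by
      ext x; simp [hmem]
    rw [hfil, Finset.sum_singleton, rootedLaplacian_update r s t i hr ((hmem _).2 rfl),
      if_pos hsome]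
    exact det_sub_vecMulVec_add_of_row_col _ (by simp [hmem]) (hsome i) hrow hcol

/-- The induction step. Since `none` does not end at `r`, the root is still a target after fusion.
-/
theorem eulerCount_option_eq_prod_mul_det (r : V) (s t : Option α → V)
    (ih : ∀ s' t' : α → V, (∀ g : V → ℚ, ∑ e, g (s' e) = ∑ e, g (t' e)) → (∃ e, t' e = r) →
      (eulerCount s' t' : ℚ) =
        ((∏ w, (Finset.card {e | t' e = w} - 1)! : ℕ) : ℚ) * (rootedLaplacian r s' t').det)
    (hbal : ∀ g : V → ℚ, ∑ e, g (s e) = ∑ e, g (t e)) (hr : ∃ e, t e = r) (hne : t none ≠ r) :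
    (eulerCount s t : ℚ) =
      ((∏ w, (Finset.card {e | t e = w} - 1)! : ℕ) : ℚ) * (rootedLaplacian r s t).det := by
  obtain ⟨x, hx⟩ : ∃ x, t (some x) = r := by
    obtain ⟨_ | x, h⟩ := hr
    · exact absurd h hne
    · exact ⟨x, h⟩
  have : Nonempty α := ⟨x⟩
  have hbal' : ∀ i, s (some i) = t none → ∀ g : V → ℚ,
      ∑ e, g (Function.update (s ∘ some) i (s none) e) = ∑ e, g ((t ∘ some) e) := by
    intro i hi g
    have h1 := sum_update_comp_some (fun a _ => g a) s t i
    have h2 := hbal g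
    rw [Fintype.sum_option (f := fun e => g (t e))] at h2
    simp only [Function.comp_apply]
    rw [h1, h2, hi]
    ring
  rw [eulerCount_option, Nat.cast_sum, Finset.sum_congr rfl fun i hi =>
    ih _ _ (hbal' i (Finset.mem_filter.1 hi).2) ⟨x, hx⟩, ← Finset.mul_sum,
    prod_factorial_card_option]
  simp only [Function.comp_apply]
  split_ifs with h
  · rw [sum_det_rootedLaplacian_update r s t hbal hne h]
    have h1 : 1 ≤ Finset.card {e | t e = t none} :=
      Finset.card_pos.2 ⟨none, by simp⟩
    rw [Nat.cast_mul, Nat.cast_sub h1]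
    push_cast
    ring
  · rw [sum_det_rootedLaplacian_update_of_forall_ne r s t hbal hne (by simpa using h), one_mul]

end

open Matrix in
/-- The number of Eulerian circuits of a balanced digraph. -/
theorem eulerCount_eq_prod_mul_det {E V : Type*} [Fintype E] [Fintype V] [DecidableEq V] (r : V)
    (s t : E → V) (hbal : ∀ g : V → ℚ, ∑ e, g (s e) = ∑ e, g (t e)) (hr : ∃ e, t e = r) :
    (eulerCount s t : ℚ) =
      ((∏ w, (Finset.card {e | t e = w} - 1)! : ℕ) : ℚ) * (rootedLaplacian r s t).det := by
  classical
  induction hE : Fintype.card E generalizing E with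
  | zero =>
    obtain ⟨e, -⟩ := hr
    exact absurd hE (@Fintype.card_ne_zero _ _ ⟨e⟩)
  | succ n ih =>
  by_cases hall : ∀ e, t e = r
  · have hs : ∀ e, s e = r := by
      have h1 := card_source_eq_card_target hbal r
      simp only [hall, Finset.filter_true] at h1
      have h2 := Finset.filter_card_eq h1
      simpa using h2
    obtain ⟨e, -⟩ := hr
    have : Nonempty E := ⟨e⟩
    rw [eulerCount_of_const s t r hs hall, Finset.prod_eq_single r]
    · have : rootedLaplacian r s t = 1 := by
        simp only [rootedLaplacian, hs, hall, sub_self, vecMulVec_zero, Finset.sum_const_zero,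
          zero_add, ← diagonal_one]
        congr 1
        ext w
        by_cases hw : w = r
        · simp [hw]
        · simp [Ne.symm hw]
      simp [this, hall]
    · intro w _ hw
      simp [hall, Ne.symm hw]
    · simp
  · push Not at hall
    obtain ⟨e₀, he₀⟩ := hall
    have hc : Fintype.card {b // b ≠ e₀} = n := by
      rw [Fintype.card_subtype_compl, hE]; simp
    let f : Option {b // b ≠ e₀} ≃ E := Equiv.optionSubtypeNe e₀
    have hf : f none = e₀ := rfl
    have key := eulerCount_option_eq_prod_mul_det r (s ∘ f) (t ∘ f)
      (fun s' t' hbal' hr' => ih s' t' hbal' hr' hc)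
      (fun g => by
        have h1 := Equiv.sum_comp f fun e => g (s e)
        have h2 := Equiv.sum_comp f fun e => g (t e)
        exact h1.trans ((hbal g).trans h2.symm))
      (by obtain ⟨e, he⟩ := hr; exact ⟨f.symm e, by simpa using he⟩)
      (by simpa [hf] using he₀)
    rw [eulerCount_comp_equiv, rootedLaplacian_comp_equiv] at key
    rw [key]
    congr 3
    ext w
    congr 2
    exact Finset.card_equiv f (by simp)

/-! ### Cyclic words as periodic sequences -/

section PeriodicCycle

variable {α : Type*} {m : ℕ} {x y : ℕ → α}

theorem rotate_map_range (hx : Function.Periodic x m) (k : ℕ) :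
    ((List.range m).map x).rotate k = (List.range m).map fun i => x (i + k) := by
  refine List.ext_getElem (by simp) fun i h1 h2 => ?_
  rw [List.getElem_rotate]
  simp [hx.map_mod_nat]

theorem coe_map_range_eq_iff (hx : Function.Periodic x m) (hy : Function.Periodic y m)
    (hm : 0 < m) :
    ((List.range m).map x : Cycle α) = ((List.range m).map y : Cycle α) ↔
      ∃ k, ∀ i, y i = x (i + k) := by
  rw [Cycle.coe_eq_coe]
  refine exists_congr fun k => ?_
  rw [rotate_map_range hx, List.map_inj_left]
  constructor
  · intro h i
    have h1 := h (i % m) (by simpa using Nat.mod_lt i hm)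
    rw [hy.map_mod_nat] at h1
    rw [← h1, ← hx.map_mod_nat, ← hx.map_mod_nat (i + k), Nat.mod_add_mod]
  · intro h i _
    exact (h i).symm

theorem exists_periodic_coe_map_range (c : Cycle α) (hc : 0 < c.length) :
    ∃ x : ℕ → α, Function.Periodic x c.length ∧ c = (((List.range c.length).map x : List α) : Cycle α) := by
  induction c using Quotient.inductionOn' with | h l
  change 0 < l.length at hc
  refine ⟨fun i => l[i % l.length]'(Nat.mod_lt _ hc), fun i => ?_, ?_⟩
  · change l[(i + l.length) % l.length]'_ = _
    simp
  · refine congrArg (fun l : List α => (l : Cycle α)) (?_ : l = (List.range l.length).map _)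
    refine List.ext_getElem (by simp) fun i h1 h2 => ?_
    simp [Nat.mod_eq_of_lt h1]

theorem cyclicBlocks_two_coe_map_range (hx : Function.Periodic x m) (hm : 2 ≤ m) :
    cyclicBlocks 2 ((List.range m).map x : Cycle α) =
      (Finset.range m).val.map fun i => [x i, x (i + 1)] := by
  have h1 : ((List.range m).map x).cyclicPermutations =
      (List.range m).map fun i => ((List.range m).map x).rotate i := by
    have hne : (List.range m).map x ≠ [] := by simp; omega
    refine List.ext_getElem ?_ fun i h1 h2 => ?_
    · rw [List.length_cyclicPermutations_of_ne_nil _ hne]; simp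
    · simp [List.getElem_cyclicPermutations]
  rw [cyclicBlocks, Cycle.lists_coe, h1, Multiset.map_coe, List.map_map]
  change _ = ((List.range m : Multiset ℕ)).map _
  rw [Multiset.map_coe]
  congr 1
  refine List.map_congr_left fun i _ => ?_
  rw [Function.comp_apply, rotate_map_range hx, ← List.map_take, List.take_range,
    Nat.min_eq_left hm]
  simp [List.range_succ, add_comm]

theorem isUniversalCycle_two_coe_map_range_iff {n : ℕ} {x : ℕ → Fin n}
    (hx : Function.Periodic x m) (hm : 2 ≤ m) :
    IsUniversalCycle n 2 ((List.range m).map x : Cycle (Fin n)) ↔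
      m = n * (n - 1) ∧ ∀ a b, a ≠ b → ∃! i, i < m ∧ x i = a ∧ x (i + 1) = b := by
  have hcount : ∀ a b, ((Finset.range m).val.map fun i => [x i, x (i + 1)]).count [a, b] = 1 ↔
      ∃! i, i < m ∧ x i = a ∧ x (i + 1) = b := by
    intro a b
    -- The multiplicity is the number of positions at which the pair occurs.
    rw [Multiset.count_map, ← Finset.filter_val, Finset.card_val, Finset.card_eq_one]
    refine exists_congr fun i => ?_
    rw [Finset.eq_singleton_iff_unique_mem]
    simp [eq_comm]
  have hperm : Fintype.card (KPermutation n 2) = n * (n - 1) := by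
    simp [Fintype.card_embedding_eq, Nat.descFactorial, mul_comm]
  rw [IsUniversalCycle, hperm, cyclicBlocks_two_coe_map_range hx hm]
  refine and_congr (by simp) ⟨fun h a b hab => ?_, fun h p => ?_⟩
  · have := h ⟨![a, b], by
      intro i j hij
      fin_cases i <;> fin_cases j <;> simp_all [Ne.symm hab]⟩
    rw [← hcount]
    simpa only [List.ofFn_succ, List.ofFn_zero] using! this
  · have := h (p 0) (p 1) (p.injective.ne (by simp))
    rw [← hcount] at this
    simpa using this

end PeriodicCycle

/-! ### Universal cycles as Eulerian circuits of the complete digraph -/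

/-- The edges of the complete digraph on `Fin n`. -/
abbrev OffDiag (n : ℕ) : Type := {p : Fin n × Fin n // p.1 ≠ p.2}

theorem card_offDiag (n : ℕ) : Fintype.card (OffDiag n) = n * (n - 1) := by
  have : Fintype.card (OffDiag n) = (Finset.univ : Finset (Fin n)).offDiag.card := by
    rw [Fintype.card_subtype]
    congr 1
    ext; simp
  rw [this, Finset.offDiag_card, Finset.card_fin, Nat.mul_sub_one]

theorem ncard_isUniversalCycle_two (n : ℕ) (hn : 3 ≤ n) :
    {c : Cycle (Fin n) | IsUniversalCycle n 2 c}.ncard =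
      eulerCount (fun e : OffDiag n => e.1.1) fun e => e.1.2 := by
  set m := n * (n - 1) with hm
  have hm2 : 2 ≤ m := by
    have : 2 ≤ n - 1 := by omega
    nlinarith
  have : NeZero m := ⟨by omega⟩
  have hcard : Fintype.card (OffDiag n) = m := card_offDiag n
  obtain ⟨e₀⟩ : Nonempty (OffDiag n) := Fintype.card_pos_iff.1 (by omega)
  -- The word of a circuit lists its sources from a fixed edge `e₀`; another starting edge would
  -- only rotate it.
  let x (σ : Equiv.Perm (OffDiag n)) (i : ℕ) : Fin n := ((σ ^ i) e₀).1.1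
  have hfull : ∀ σ : Equiv.Perm (OffDiag n), IsFullCycle σ →
      σ.IsCycleOn (Finset.univ : Finset (OffDiag n)) := by
    intro σ hσ
    exact ⟨by simp, fun a _ b _ => hσ a b⟩
  have hper : ∀ σ, IsFullCycle σ → Function.Periodic (x σ) m := by
    intro σ hσ i
    have := (hfull σ hσ).pow_card_apply (Finset.mem_univ e₀)
    rw [Finset.card_univ, hcard] at this
    simp only [x]
    rw [pow_add, Equiv.Perm.mul_apply, this]
  have hpair : ∀ σ : Equiv.Perm (OffDiag n), (∀ e, (σ e).1.1 = e.1.2) → ∀ i,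
      (x σ i, x σ (i + 1)) = ((σ ^ i) e₀).1 := by
    intro σ hσ i
    ext1
    · rfl
    · simp only [x]
      rw [pow_succ', Equiv.Perm.mul_apply, hσ]
  rw [eulerCount, ← Nat.card_coe_set_eq]
  symm
  refine Nat.card_eq_of_bijective
    (f := fun σ => ⟨((List.range m).map (x σ.1) : Cycle (Fin n)), ?_⟩) ⟨?_, ?_⟩
  · obtain ⟨σ, h1, h2⟩ := σ
    refine (isUniversalCycle_two_coe_map_range_iff (hper σ h1) hm2).2 ⟨rfl, fun a b hab => ?_⟩
    obtain ⟨i, hi, hi'⟩ := (hfull σ h1).exists_pow_eq (Finset.mem_univ e₀)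
      (Finset.mem_univ (⟨(a, b), hab⟩ : OffDiag n))
    rw [Finset.card_univ, hcard] at hi
    refine ⟨i, ⟨hi, ?_⟩, ?_⟩
    · have := hpair σ h2 i
      rw [hi'] at this
      simpa using this
    · rintro j ⟨hj, hja, hjb⟩
      have h3 := hpair σ h2 j
      rw [hja, hjb] at h3
      have h4 : (σ ^ j) e₀ = (σ ^ i) e₀ := by rw [hi']; exact Subtype.ext h3.symm
      rw [(hfull σ h1).pow_apply_eq_pow_apply (Finset.mem_univ e₀), Finset.card_univ, hcard] at h4
      exact Nat.ModEq.eq_of_lt_of_lt h4 hj hi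
  · rintro ⟨σ, h1, h2⟩ ⟨τ, h3, h4⟩ h
    have h5 : ((List.range m).map (x σ) : Cycle (Fin n)) = ((List.range m).map (x τ) : Cycle _) :=
      congrArg Subtype.val h
    rw [coe_map_range_eq_iff (hper σ h1) (hper τ h3) (by omega)] at h5
    obtain ⟨k, hk⟩ := h5
    -- Consecutive letters determine the edge, so words that agree up to a shift give the same
    -- successor map.
    have h6 : ∀ i, (τ ^ i) e₀ = (σ ^ (i + k)) e₀ := by
      intro i
      apply Subtype.ext
      rw [← hpair σ h2, ← hpair τ h4, hk, hk, add_right_comm]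
    congr 1
    ext1 e
    obtain ⟨i, -, rfl⟩ := (hfull τ h3).exists_pow_eq (Finset.mem_univ e₀) (Finset.mem_univ e)
    rw [← Equiv.Perm.mul_apply τ, ← pow_succ', h6, h6, ← Equiv.Perm.mul_apply, ← pow_succ',
      add_right_comm]
  · rintro ⟨c, hc⟩
    have hlen : c.length = m := by
      have := hc.1
      simpa [Fintype.card_embedding_eq, Nat.descFactorial, mul_comm] using this
    obtain ⟨y, hy, hcy⟩ := exists_periodic_coe_map_range c (by omega)
    rw [hlen] at hy hcy
    subst hcy
    have hu := ((isUniversalCycle_two_coe_map_range_iff hy hm2).1 hc).2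
    choose idx hidx _ using fun e : OffDiag n => hu e.1.1 e.1.2 e.2
    have hinj : Function.Injective fun e : OffDiag n => (⟨idx e, (hidx e).1⟩ : Fin m) := by
      intro e f hef
      have hef' : idx e = idx f := by simpa using hef
      have h1 := (hidx e).2
      have h2 := (hidx f).2
      rw [hef'] at h1
      exact Subtype.ext (Prod.ext (h1.1.symm.trans h2.1) (h1.2.symm.trans h2.2))
    let g : OffDiag n ≃ Fin m := Equiv.ofBijective _
      ((Fintype.bijective_iff_injective_and_card _).2 ⟨hinj, by simp [hcard]⟩)
    have hg1 : ∀ e, y (g e) = e.1.1 := fun e => (hidx e).2.1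
    have hg2 : ∀ e, y (g e + 1) = e.1.2 := fun e => (hidx e).2.2
    -- `g` gives the unique position of each edge in the word; its successor is the edge at the next
    -- position modulo `m`.
    let σ : Equiv.Perm (OffDiag n) := g.symm.permCongr (Equiv.addRight 1)
    have hσ : ∀ (i : ℕ) e, (g ((σ ^ i) e) : ℕ) = (g e + i) % m := by
      intro i e
      induction i with
      | zero => simp [Nat.mod_eq_of_lt (g e).2]
      | succ i ih =>
        have h1 : g (σ ((σ ^ i) e)) = g ((σ ^ i) e) + 1 := by simp [σ]
        rw [pow_succ', Equiv.Perm.mul_apply, h1, Fin.val_add, ih, Fin.val_one', Nat.add_mod_mod,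
          Nat.mod_add_mod, add_assoc]
    have hyσ : ∀ (i : ℕ) e, y (i + g e) = ((σ ^ i) e).1.1 := by
      intro i e
      rw [← hg1, hσ, hy.map_mod_nat, add_comm]
    have hσfull : IsFullCycle σ := by
      intro e f
      refine ⟨((g f + (m - g e) : ℕ) : ℤ), ?_⟩
      rw [zpow_natCast]
      apply g.injective
      have := (g e).2
      ext1
      rw [hσ, show (g e : ℕ) + (g f + (m - g e)) = g f + m by omega, Nat.add_mod_right,
        Nat.mod_eq_of_lt (g f).2]
    refine ⟨⟨σ, hσfull, fun e => ?_⟩, Subtype.ext ?_⟩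
    · have := hyσ 1 e
      rw [pow_one] at this
      rw [← this, add_comm, hg2]
    · refine ((coe_map_range_eq_iff hy (hper σ hσfull) (by omega)).2 ⟨g e₀, fun i => ?_⟩).symm
      exact (hyσ i e₀).symm

open Matrix in
theorem rootedLaplacian_offDiag {n : ℕ} (hn : 3 ≤ n) (r : Fin n) :
    rootedLaplacian r (fun e : OffDiag n => e.1.1) (fun e => e.1.2) =
      (n : ℚ) • (1 : Matrix (Fin n) (Fin n) ℚ) - vecMulVec 1 1 + Matrix.single r r 1 := by
  rw [rootedLaplacian]
  congr 1
  · let F (p : Fin n × Fin n) : Matrix (Fin n) (Fin n) ℚ :=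
      vecMulVec (Pi.single p.1 1) (Pi.single p.1 1 - Pi.single p.2 1)
    have h1 : ∑ e : OffDiag n, F e = ∑ p : Fin n × Fin n, F p := by
      rw [← Finset.sum_subtype {p : Fin n × Fin n | p.1 ≠ p.2} (by simp) F]
      refine Finset.sum_filter_of_ne fun p _ hp hp' => hp ?_
      simp [F, hp']
    refine h1.trans ?_
    rw [Fintype.sum_prod_type]
    ext i j
    simp [F, vecMulVec_apply, Matrix.sum_apply, Pi.single_apply, mul_sub, Finset.sum_sub_distrib,
      Matrix.one_apply]
  · rw [← diagonal_single]
    congr 1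
    ext w
    have h : ¬ ∀ e : OffDiag n, e.1.2 ≠ w := by
      have : Nontrivial (Fin n) := Fin.nontrivial_iff_two_le.2 (by omega)
      obtain ⟨v, hv⟩ := exists_ne w
      exact fun h => h ⟨(v, w), hv⟩ rfl
    simp only [h, or_false, Pi.single_apply]

theorem theorem1 (n : ℕ) (hn : 3 ≤ n) :
    {c : Cycle (Fin n) | IsUniversalCycle n 2 c}.ncard = n ^ (n - 2) * ((n - 2)!) ^ n := by
  let r : Fin n := ⟨0, by omega⟩
  have : Nontrivial (Fin n) := Fin.nontrivial_iff_two_le.2 (by omega)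
  have hdeg : ∀ w : Fin n, Finset.card {e : OffDiag n | e.1.2 = w} = n - 1 := by
    intro w
    have : Finset.card {e : OffDiag n | e.1.2 = w} = (Finset.univ.erase w).card := by
      refine Finset.card_bij' (fun e _ => e.1.1)
        (fun v hv => ⟨(v, w), Finset.ne_of_mem_erase hv⟩) ?_ ?_ ?_ ?_
      · rintro ⟨⟨a, b⟩, h⟩ h'
        obtain rfl : b = w := by simpa using h'
        simpa using h
      · simp
      · rintro ⟨⟨a, b⟩, h⟩ h'
        obtain rfl : b = w := by simpa using h'
        rfl
      · simp
    rw [this, Finset.card_erase_of_mem (Finset.mem_univ w), Finset.card_fin]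
  have hbal : ∀ g : Fin n → ℚ, ∑ e : OffDiag n, g e.1.1 = ∑ e : OffDiag n, g e.1.2 := fun g =>
    Equiv.sum_comp ((Equiv.prodComm (Fin n) (Fin n)).subtypeEquiv fun p => ne_comm)
      fun e : OffDiag n => g e.1.2
  have hr : ∃ e : OffDiag n, e.1.2 = r := by
    obtain ⟨v, hv⟩ := exists_ne r
    exact ⟨⟨(v, r), hv⟩, rfl⟩
  have key := eulerCount_eq_prod_mul_det r (fun e : OffDiag n => e.1.1) (fun e => e.1.2) hbal hr
  rw [rootedLaplacian_offDiag hn, det_smul_one_sub_ones_add_single (by omega)] at key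
  simp only [hdeg, Finset.prod_const, Finset.card_fin, Nat.sub_sub] at key
  rw [ncard_isUniversalCycle_two n hn, mul_comm]
  exact_mod_cast key
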